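/- **Theorem 2.** Each recursively enumerable proof system for the first-order language on natural numbers with $0$, $1$, $+$, $\cdot$, and $=$ either proves a false sentence or fails to prove a true sentence. Here the language is the following. Its strings are finite sequences over a fixed alphabet of 53 characters: the letters $a,\dots,z$, the digits $0,\dots,9$, and the characters `"`, `\`, `=`, $\neq$, `(`, `)`, `~`, `&`, `|`, `-`, `>`, `A`, `E`, `:`, `+`, `*`, `<`. A variable is a lower case letter followed by zero or more digits. A number literal is `0` or a non-empty sequence of digits that does not start with `0`. Terms are built from variables and number literals with `+`, `*` and parentheses; `*` has higher precedence than `+`. Atomic propositions are $t=u$ and $t\neq u$ for terms $t,u$. Formulas are built from atomic propositions with parentheses, `~` (not), `&` (and), `|` (or), `->` (implies), `A`$x$`:` (for every natural number $x$) and `E`$x$`:` (there is a natural number $x$); the precedences of `~`, `&`, `|`, `->`, `:` decrease in this order, so that the scope of a quantifier extends as far to the right as possible, and binary operators associate to the left. A sentence is a formula without free variables; it is true or false according to its meaning in the natural numbers. A Turing machine has a tape that is infinite in both directions, the 53 characters and a blank as tape symbols, and states $0,\dots,r$ for some $r\ge 1$. For each state other than $0$ and each tape symbol it has exactly one rule,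 which gives the symbol to be written, the next state, and whether the head moves one cell to the left, one cell to the right, or not at all. It starts in state $1$ with its head on the first character of the input on an otherwise blank tape, and it halts when it enters state $0$. A recursively enumerable proof system is a Turing machine that does not halt on any string that is not a sentence; it proves a sentence if and only if it halts on that sentence. -/

import Mathlib

namespace NatArith

/-! ### Characters and strings -/

/-- The 53 characters: 26 lower case letters, 10 digits and 17 other characters. -/
inductive Sym : Type
  | letter (i : Fin 26)
  | digit (d : Fin 10)
  | quote | backslash | eq | ne | lpar | rpar | tilde | amp | bar | dash | gt
  | capA | capE | colon | plus | star | lt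
  deriving DecidableEq

/-- A string is a finite sequence of characters. -/
abbrev Str : Type := List Sym

/-! ### Abstract formulas of arithmetic and their meaning in the natural numbers -/

/-- A variable: a lower case letter followed by zero or more digits. -/
structure Var : Type where
  letter : Fin 26
  digits : List (Fin 10)
  deriving DecidableEq

/-- The string that a variable is. -/
def Var.str (x : Var) : Str := Sym.letter x.letter :: x.digits.map Sym.digit

/-- Terms, up to the way they are written. -/
inductive Tm : Type
  | var (x : Var)
  | num (n : ℕ)
  | add (t u : Tm)
  | mul (t u : Tm)

/-- The value of a term when the variables contain the numbers given by `v`. -/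
def Tm.val (v : Var → ℕ) : Tm → ℕ
  | .var x => v x
  | .num n => n
  | .add t u => t.val v + u.val v
  | .mul t u => t.val v * u.val v

/-- The variables that occur in a term. -/
def Tm.vars : Tm → Set Var
  | .var x => {x}
  | .num _ => ∅
  | .add t u => t.vars ∪ u.vars
  | .mul t u => t.vars ∪ u.vars

/-- First-order formulas, up to the way they are written. -/
inductive Fml : Type
  | eq (t u : Tm)
  | ne (t u : Tm)
  | not (p : Fml)
  | and (p q : Fml)
  | or (p q : Fml)
  | imp (p q : Fml)
  | all (x : Var) (p : Fml)
  | ex (x : Var) (p : Fml)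

/-- The formula holds in the natural numbers, when the variables contain the numbers given by `v`. -/
def Fml.Holds : Fml → (Var → ℕ) → Prop
  | .eq t u, v => t.val v = u.val v
  | .ne t u, v => t.val v ≠ u.val v
  | .not p, v => ¬ p.Holds v
  | .and p q, v => p.Holds v ∧ q.Holds v
  | .or p q, v => p.Holds v ∨ q.Holds v
  | .imp p q, v => p.Holds v → q.Holds v
  | .all x p, v => ∀ n : ℕ, p.Holds (Function.update v x n)
  | .ex x p, v => ∃ n : ℕ, p.Holds (Function.update v x n)

/-- The free variables of a formula. -/
def Fml.free : Fml → Set Var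
  | .eq t u => t.vars ∪ u.vars
  | .ne t u => t.vars ∪ u.vars
  | .not p => p.free
  | .and p q => p.free ∪ q.free
  | .or p q => p.free ∪ q.free
  | .imp p q => p.free ∪ q.free
  | .all x p => p.free \ {x}
  | .ex x p => p.free \ {x}

/-! ### How terms and formulas are written as strings -/

/-- A number literal: the digit 0 alone, or a non-empty sequence of digits that does not start
with 0. -/
def IsLiteral (ds : List (Fin 10)) : Prop :=
  ds = [0] ∨ (ds ≠ [] ∧ ds.head? ≠ some 0)

/-- The number that a sequence of decimal digits denotes. -/
def decimalValue (ds : List (Fin 10)) : ℕ := ds.foldl (fun n d => 10 * n + (d : ℕ)) 0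

/-- `ReadsTm k s t`: the string `s` is a term that is read as `t`.
The level `k` tells which operators may be outermost in `s`:
0: everything; 1: everything except `+`; 2: only variables, literals and parentheses.
Operators associate to the left. -/
inductive ReadsTm : ℕ → Str → Tm → Prop
  | var (x : Var) : ReadsTm 2 x.str (.var x)
  | lit (ds : List (Fin 10)) (h : IsLiteral ds) :
      ReadsTm 2 (ds.map Sym.digit) (.num (decimalValue ds))
  | paren {s : Str} {t : Tm} (h : ReadsTm 0 s t) :
      ReadsTm 2 ([Sym.lpar] ++ s ++ [Sym.rpar]) t
  | mul {s₁ s₂ : Str} {t u : Tm} (h₁ : ReadsTm 1 s₁ t) (h₂ : ReadsTm 2 s₂ u) :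
      ReadsTm 1 (s₁ ++ [Sym.star] ++ s₂) (.mul t u)
  | add {s₁ s₂ : Str} {t u : Tm} (h₁ : ReadsTm 0 s₁ t) (h₂ : ReadsTm 1 s₂ u) :
      ReadsTm 0 (s₁ ++ [Sym.plus] ++ s₂) (.add t u)
  | weaken {k : ℕ} {s : Str} {t : Tm} (h : ReadsTm (k + 1) s t) : ReadsTm k s t

/-- `ReadsFml k b s p`: the string `s` is a formula that is read as `p`.
The level `k` tells which binary and unary connectives may be outermost in `s`:
0: all; 1: all except `->`; 2: also not `|`; 3: also not `&`; 4: also not `~`.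
Binary connectives associate to the left. The colon of a quantifier has the lowest precedence:
the scope of a quantifier extends to the right as far as possible. The flag `b` is `true` when
some quantifier outside parentheses has its scope extend to the end of `s`; then `s` cannot be the
left operand of a connective. -/
inductive ReadsFml : ℕ → Bool → Str → Fml → Prop
  | eq {s₁ s₂ : Str} {t u : Tm} (h₁ : ReadsTm 0 s₁ t) (h₂ : ReadsTm 0 s₂ u) :
      ReadsFml 4 false (s₁ ++ [Sym.eq] ++ s₂) (.eq t u)
  | ne {s₁ s₂ : Str} {t u : Tm} (h₁ : ReadsTm 0 s₁ t) (h₂ : ReadsTm 0 s₂ u) :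
      ReadsFml 4 false (s₁ ++ [Sym.ne] ++ s₂) (.ne t u)
  | paren {b : Bool} {s : Str} {p : Fml} (h : ReadsFml 0 b s p) :
      ReadsFml 4 false ([Sym.lpar] ++ s ++ [Sym.rpar]) p
  | not {b : Bool} {s : Str} {p : Fml} (h : ReadsFml 3 b s p) :
      ReadsFml 3 b ([Sym.tilde] ++ s) (.not p)
  | and {b : Bool} {s₁ s₂ : Str} {p q : Fml} (h₁ : ReadsFml 2 false s₁ p)
      (h₂ : ReadsFml 3 b s₂ q) : ReadsFml 2 b (s₁ ++ [Sym.amp] ++ s₂) (.and p q)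
  | or {b : Bool} {s₁ s₂ : Str} {p q : Fml} (h₁ : ReadsFml 1 false s₁ p)
      (h₂ : ReadsFml 2 b s₂ q) : ReadsFml 1 b (s₁ ++ [Sym.bar] ++ s₂) (.or p q)
  | imp {b : Bool} {s₁ s₂ : Str} {p q : Fml} (h₁ : ReadsFml 0 false s₁ p)
      (h₂ : ReadsFml 1 b s₂ q) :
      ReadsFml 0 b (s₁ ++ [Sym.dash, Sym.gt] ++ s₂) (.imp p q)
  | all {b : Bool} {s : Str} {p : Fml} (x : Var) (h : ReadsFml 0 b s p) :
      ReadsFml 4 true ([Sym.capA] ++ x.str ++ [Sym.colon] ++ s) (.all x p)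
  | ex {b : Bool} {s : Str} {p : Fml} (x : Var) (h : ReadsFml 0 b s p) :
      ReadsFml 4 true ([Sym.capE] ++ x.str ++ [Sym.colon] ++ s) (.ex x p)
  | weaken {k : ℕ} {b : Bool} {s : Str} {p : Fml} (h : ReadsFml (k + 1) b s p) :
      ReadsFml k b s p

/-- The string `s` is a formula, and it is read as `p`. -/
def IsFormula (s : Str) (p : Fml) : Prop := ∃ b : Bool, ReadsFml 0 b s p

/-- The string is a sentence: a formula without free variables. -/
def IsSentence (s : Str) : Prop := ∃ p : Fml, IsFormula s p ∧ p.free = ∅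

/-- The string is a sentence that holds in the natural numbers. -/
def IsTrueSentence (s : Str) : Prop :=
  ∃ p : Fml, IsFormula s p ∧ p.free = ∅ ∧ ∀ v : Var → ℕ, p.Holds v

/-- The string is a sentence that does not hold in the natural numbers. -/
def IsFalseSentence (s : Str) : Prop :=
  ∃ p : Fml, IsFormula s p ∧ p.free = ∅ ∧ ∀ v : Var → ℕ, ¬ p.Holds v

/-! ### Turing machines -/

/-- Head movements: one cell to the left, one cell to the right, or none. -/
inductive Move : Type
  | L | R | N

/-- A tape symbol is one of the 53 characters or the blank, which is `none`. -/
abbrev TapeSym : Type := Option Sym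

/-- A Turing machine: its states are `0, …, r` with `r` positive, state `0` is final, and there is
exactly one rule for each state other than `0` and each tape symbol. -/
structure Machine : Type where
  r : ℕ
  r_pos : 0 < r
  rule : TapeSym → {q : Fin (r + 1) // q ≠ 0} → TapeSym × Fin (r + 1) × Move

/-- A state of the control unit together with the two-way infinite tape and the head position. -/
structure Machine.Config (M : Machine) : Type where
  state : Fin (M.r + 1)
  tape : Turing.Tape TapeSym

/-- Moving the head. -/
def Move.apply : Move → Turing.Tape TapeSym → Turing.Tape TapeSym
  | .L, T => T.move Turing.Dir.left
  | .R, T => T.move Turing.Dir.right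
  | .N, T => T

/-- One computation step; a configuration in state `0` does not change any more. -/
def Machine.step (M : Machine) (c : M.Config) : M.Config :=
  if h : c.state = 0 then c
  else
    let a := M.rule c.tape.head ⟨c.state, h⟩
    ⟨a.2.1, a.2.2.apply (c.tape.write a.1)⟩

/-- The initial configuration: state `1`, the input on an otherwise blank tape, and the head on the
first character of the input. -/
def Machine.init (M : Machine) (s : Str) : M.Config :=
  ⟨⟨1, Nat.succ_lt_succ M.r_pos⟩, Turing.Tape.mk₁ (s.map some)⟩

/-- The machine eventually enters state `0` when given the input `s`. -/
def Machine.Halts (M : Machine) (s : Str) : Prop :=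
  ∃ n : ℕ, (M.step^[n] (M.init s)).state = 0

/-! ### Proof systems -/

/-- A recursively enumerable proof system for natural number arithmetic: a Turing machine that does
not halt on any string that is not a sentence. -/
structure REProofSystem : Type where
  machine : Machine
  not_halts : ∀ s : Str, ¬ IsSentence s → ¬ machine.Halts s

/-- A sentence is proven if and only if the machine halts on it. -/
def REProofSystem.Proves (P : REProofSystem) (s : Str) : Prop :=
  IsSentence s ∧ P.machine.Halts s

end NatArith

/-!
The graph of every primitive recursive function is definable in arithmetic, since Gödel's `β`
function encodes the finite sequence of the intermediate values by one number. Hence the set of the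
strings on which a Turing machine halts is arithmetical: the machine runs by a primitive recursive
step function, and halting is one existential quantifier over the number of steps. The complement of
an arithmetical set `A` of strings is arithmetical as well, so a formula can be applied to its own
code to give a sentence `s` that holds if and only if `s` is not in `A`. If `s` is in `A` then `s`
is a false sentence in `A`, and otherwise `s` is a true sentence outside `A`.
-/

namespace NatArith

/-! ### Arithmetical relations and functions -/

/-- An arithmetical relation on natural numbers: for all variables `x 0, …, x (n - 1)`, distinct or
not, it is defined by a formula in these variables. Quantifying over the variables makes renaming
and the choice of fresh bound variables unproblematic. The parsing level `4 false` lets the string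
of the formula be an operand of every connective. -/
def ArithRel {n : ℕ} (R : (Fin n → ℕ) → Prop) : Prop :=
  ∀ x : Fin n → Var, ∃ s p, ReadsFml 4 false s p ∧ p.free ⊆ Set.range x ∧
    ∀ v, p.Holds v ↔ R (v ∘ x)

/-- An arithmetical function: its graph is an arithmetical relation, with the value of the function
as the first component. -/
def ArithFun {n : ℕ} (f : (Fin n → ℕ) → ℕ) : Prop :=
  ArithRel fun w : Fin (n + 1) → ℕ => w 0 = f (Fin.tail w)

theorem ReadsTm.to_zero {s : Str} {t : Tm} : ∀ {k : ℕ}, ReadsTm k s t → ReadsTm 0 s t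
  | 0, h => h
  | _ + 1, h => h.weaken.to_zero

theorem ReadsFml.to_zero {b : Bool} {s : Str} {p : Fml} :
    ∀ {k : ℕ}, ReadsFml k b s p → ReadsFml 0 b s p
  | 0, h => h
  | _ + 1, h => h.weaken.to_zero

instance : Infinite Var :=
  Infinite.of_injective (Var.mk 0) fun _ _ h => (Var.mk.inj h).2

namespace ArithRel

variable {m n : ℕ} {P Q : (Fin n → ℕ) → Prop} {R : (Fin n → ℕ) → ℕ → Prop}

theorem of_iff (hP : ArithRel P) (h : ∀ v, P v ↔ Q v) : ArithRel Q :=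
  funext (fun v => propext (h v)) ▸ hP

theorem comp (hP : ArithRel P) (ρ : Fin n → Fin m) : ArithRel fun v => P (v ∘ ρ) := fun x => by
  obtain ⟨s, p, hs, hfree, hp⟩ := hP (x ∘ ρ)
  exact ⟨s, p, hs, hfree.trans (Set.range_comp_subset_range ρ x), hp⟩

protected theorem not (hP : ArithRel P) : ArithRel fun v => ¬ P v := fun x => by
  obtain ⟨s, p, hs, hfree, hp⟩ := hP x
  exact ⟨_, .not p, .paren (ReadsFml.not hs.weaken).to_zero, hfree, fun v => not_congr (hp v)⟩

protected theorem and (hP : ArithRel P) (hQ : ArithRel Q) : ArithRel fun v => P v ∧ Q v :=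
  fun x => by
  obtain ⟨s, p, hs, hfree, hp⟩ := hP x
  obtain ⟨s', q, hs', hfree', hq⟩ := hQ x
  exact ⟨_, .and p q, .paren (ReadsFml.and hs.weaken.weaken hs'.weaken).to_zero,
    Set.union_subset hfree hfree', fun v => and_congr (hp v) (hq v)⟩

protected theorem or (hP : ArithRel P) (hQ : ArithRel Q) : ArithRel fun v => P v ∨ Q v :=
  (hP.not.and hQ.not).not.of_iff fun _ => or_iff_not_and_not.symm

protected theorem imp (hP : ArithRel P) (hQ : ArithRel Q) : ArithRel fun v => P v → Q v :=
  (hP.not.or hQ).of_iff fun _ => imp_iff_not_or.symm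

protected theorem ex (hR : ArithRel fun w : Fin (n + 1) → ℕ => R (Fin.tail w) (w 0)) :
    ArithRel fun v => ∃ a, R v a := fun x => by
  obtain ⟨y, hy⟩ := (Set.finite_range x).exists_notMem
  obtain ⟨s, p, hs, hfree, hp⟩ := hR (Fin.cons y x)
  refine ⟨_, .ex y p, .paren (ReadsFml.ex y hs.to_zero).to_zero, ?_,
    fun v => exists_congr fun a => (hp _).trans ?_⟩
  · rwa [Fml.free, Set.sdiff_singleton_subset_iff, ← Fin.range_cons]
  · have htail : Function.update v y a ∘ x = v ∘ x :=
      Function.update_comp_eq_of_notMem_range v a hy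
    change R (Function.update v y a ∘ x) (Function.update v y a y) ↔ R (v ∘ x) a
    rw [htail, Function.update_self]

protected theorem all (hR : ArithRel fun w : Fin (n + 1) → ℕ => R (Fin.tail w) (w 0)) :
    ArithRel fun v => ∀ a, R v a :=
  (ArithRel.ex (R := fun v a => ¬ R v a) hR.not).not.of_iff fun _ => not_exists_not

theorem subst {f : (Fin n → ℕ) → ℕ}
    (hR : ArithRel fun w : Fin (n + 1) → ℕ => R (Fin.tail w) (w 0)) (hf : ArithFun f) :
    ArithRel fun v => R v (f v) :=
  (ArithRel.ex (R := fun v a => a = f v ∧ R v a) (hf.and hR)).of_iff fun _ => exists_eq_left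

protected theorem eq {f g : (Fin n → ℕ) → ℕ} (hf : ArithFun f) (hg : ArithFun g) :
    ArithRel fun v => f v = g v :=
  subst (R := fun v a => a = g v) hg hf

end ArithRel

namespace ArithFun

variable {n : ℕ} {f g : (Fin n → ℕ) → ℕ}

theorem of_graph {R : (Fin n → ℕ) → ℕ → Prop}
    (hR : ArithRel fun w : Fin (n + 1) → ℕ => R (Fin.tail w) (w 0))
    (h : ∀ v y, R v y ↔ y = f v) : ArithFun f :=
  hR.of_iff fun w => h (Fin.tail w) (w 0)

theorem of_readsTm (h : ∀ x : Fin n → Var, ∃ s t, ReadsTm 0 s t ∧ t.vars ⊆ Set.range x ∧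
    ∀ v, t.val v = f (v ∘ x)) : ArithFun f := fun x => by
  obtain ⟨s, t, hs, hvars, ht⟩ := h (Fin.tail x)
  refine ⟨_, .eq (.var (x 0)) t, .eq (ReadsTm.var (x 0)).to_zero hs, ?_, fun v => ?_⟩
  · rw [Fin.range_fin_succ]
    exact Set.union_subset_union_right {x 0} hvars
  · rw [Fml.Holds, ht]
    rfl

theorem comp (hf : ArithFun f) {m : ℕ} (ρ : Fin n → Fin m) : ArithFun fun v => f (v ∘ ρ) :=
  ArithRel.comp hf (Fin.cons 0 (Fin.succ ∘ ρ))

theorem weaken (hf : ArithFun f) : ArithFun fun w : Fin (n + 1) → ℕ => f (Fin.tail w) :=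
  hf.comp Fin.succ

theorem comp₁ {F : ℕ → ℕ} (hF : ArithFun fun v : Fin 1 → ℕ => F (v 0)) (hf : ArithFun f) :
    ArithFun fun v => F (f v) :=
  ArithRel.subst (R := fun w a => w 0 = F a) (ArithRel.comp hF ![1, 0]) hf.weaken

theorem comp₂ {F : ℕ → ℕ → ℕ} (hF : ArithFun fun v : Fin 2 → ℕ => F (v 0) (v 1))
    (hf : ArithFun f) (hg : ArithFun g) : ArithFun fun v => F (f v) (g v) :=
  ArithRel.subst (R := fun w a => w 0 = F a (g (Fin.tail w)))
    (ArithRel.subst (R := fun w b => w 1 = F (w 0) b) (ArithRel.comp hF ![2, 1, 0])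
      hg.weaken.weaken) hf.weaken

theorem var (i : Fin n) : ArithFun fun v => v i :=
  of_readsTm fun x => ⟨_, .var (x i), (ReadsTm.var (x i)).to_zero, by simp [Tm.vars], fun _ => rfl⟩

theorem zero : ArithFun fun _ : Fin n → ℕ => 0 :=
  of_readsTm fun _ => ⟨_, _, (ReadsTm.lit [0] (.inl rfl)).to_zero, Set.empty_subset _, fun _ => rfl⟩

theorem one : ArithFun fun _ : Fin n → ℕ => 1 :=
  of_readsTm fun _ =>
    ⟨_, _, (ReadsTm.lit [1] (.inr (by decide))).to_zero, Set.empty_subset _, fun _ => rfl⟩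

protected theorem add (hf : ArithFun f) (hg : ArithFun g) : ArithFun fun v => f v + g v :=
  comp₂ (of_readsTm fun x => ⟨_, .add (.var (x 0)) (.var (x 1)),
    .add (ReadsTm.var (x 0)).to_zero (ReadsTm.var (x 1)).weaken,
    by simp [Tm.vars, Set.insert_subset_iff], fun _ => rfl⟩) hf hg

protected theorem mul (hf : ArithFun f) (hg : ArithFun g) : ArithFun fun v => f v * g v :=
  comp₂ (of_readsTm fun x => ⟨_, .mul (.var (x 0)) (.var (x 1)),
    (ReadsTm.mul (ReadsTm.var (x 0)).weaken (ReadsTm.var (x 1))).to_zero,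
    by simp [Tm.vars, Set.insert_subset_iff], fun _ => rfl⟩) hf hg

end ArithFun

/-! ### Primitive recursive functions are arithmetical -/

theorem ArithRel.lt {n : ℕ} {f g : (Fin n → ℕ) → ℕ} (hf : ArithFun f) (hg : ArithFun g) :
    ArithRel fun v => f v < g v :=
  (ArithRel.ex (R := fun v d => g v = f v + 1 + d)
    (.eq hg.weaken ((hf.weaken.add .one).add (.var 0)))).of_iff fun _ => le_iff_exists_add.symm

theorem exists_beta_eq (f : ℕ → ℕ) (n : ℕ) : ∃ c, ∀ m ≤ n, Nat.beta c m = f m := by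
  refine ⟨Nat.unbeta ((List.range (n + 1)).map f), fun m hm => ?_⟩
  simpa using Nat.beta_unbeta_coe ((List.range (n + 1)).map f) ⟨m, by simpa using by omega⟩

theorem eq_natRec_iff_exists_beta {z : ℕ} {g : ℕ → ℕ → ℕ} {n y : ℕ} :
    y = n.rec (motive := fun _ => ℕ) z g ↔
      ∃ c, Nat.beta c 0 = z ∧ y = Nat.beta c n ∧
        ∀ m, m < n → Nat.beta c (m + 1) = g m (Nat.beta c m) := by
  constructor
  · rintro rfl
    obtain ⟨c, hc⟩ := exists_beta_eq (fun n => n.rec (motive := fun _ => ℕ) z g) n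
    exact ⟨c, hc 0 n.zero_le, (hc n le_rfl).symm, fun m hm => by
      rw [hc (m + 1) hm, hc m hm.le]⟩
  · rintro ⟨c, hzero, rfl, hsucc⟩
    have hrec (m : ℕ) (hm : m ≤ n) : Nat.beta c m = m.rec (motive := fun _ => ℕ) z g := by
      induction m with
      | zero => exact hzero
      | succ m ih => rw [hsucc m hm, ih (by omega)]
    exact hrec n le_rfl

namespace ArithFun

variable {n : ℕ} {f g : (Fin n → ℕ) → ℕ}

protected theorem pair (hf : ArithFun f) (hg : ArithFun g) :
    ArithFun fun v => Nat.pair (f v) (g v) := by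
  have hlt := ArithRel.lt hf.weaken hg.weaken
  have hthen := ArithRel.eq (var 0) ((hg.mul hg).add hf).weaken
  have helse := ArithRel.eq (var 0) (((hf.mul hf).add hf).add hg).weaken
  refine of_graph
    (R := fun v y => f v < g v ∧ y = g v * g v + f v ∨ ¬ f v < g v ∧ y = f v * f v + f v + g v)
    ((hlt.and hthen).or (hlt.not.and helse)) fun v y => ?_
  unfold Nat.pair
  split_ifs with h <;> simp [h]

theorem unpair_fst (hf : ArithFun f) : ArithFun fun v => (f v).unpair.1 := by
  refine of_graph (R := fun v y => ∃ b, f v = Nat.pair y b)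
    (.ex (.eq hf.weaken.weaken ((var 1).pair (var 0)))) fun v y => ⟨?_, ?_⟩
  · rintro ⟨b, h⟩
    rw [h, Nat.unpair_pair]
  · rintro rfl
    exact ⟨(f v).unpair.2, (Nat.pair_unpair _).symm⟩

theorem unpair_snd (hf : ArithFun f) : ArithFun fun v => (f v).unpair.2 := by
  refine of_graph (R := fun v y => ∃ a, f v = Nat.pair a y)
    (.ex (.eq hf.weaken.weaken ((var 0).pair (var 1)))) fun v y => ⟨?_, ?_⟩
  · rintro ⟨a, h⟩
    rw [h, Nat.unpair_pair]
  · rintro rfl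
    exact ⟨(f v).unpair.1, (Nat.pair_unpair _).symm⟩

theorem mod_succ (hf : ArithFun f) (hg : ArithFun g) : ArithFun fun v => f v % (g v + 1) := by
  have hg' := (hg.add one).weaken
  refine of_graph (R := fun v y => y < g v + 1 ∧ ∃ q, f v = (g v + 1) * q + y)
    (.and (.lt (var 0) hg') (.ex (.eq hf.weaken.weaken ((hg'.weaken.mul (var 0)).add (var 1)))))
    fun v y => ⟨?_, ?_⟩
  · rintro ⟨hlt, q, h⟩
    rw [h, Nat.mul_add_mod, Nat.mod_eq_of_lt hlt]
  · rintro rfl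
    exact ⟨Nat.mod_lt _ (Nat.succ_pos _), _, (Nat.div_add_mod _ _).symm⟩

protected theorem beta (hf : ArithFun f) (hg : ArithFun g) :
    ArithFun fun v => Nat.beta (f v) (g v) :=
  hf.unpair_fst.mod_succ ((hg.add one).mul hf.unpair_snd)

theorem prec {F G : ℕ → ℕ} (hF : ArithFun fun v : Fin 1 → ℕ => F (v 0))
    (hG : ArithFun fun v : Fin 1 → ℕ => G (v 0)) :
    ArithFun fun v : Fin 1 → ℕ => Nat.unpaired (fun z n =>
      n.rec (F z) fun y IH => G (Nat.pair z (Nat.pair y IH))) (v 0) := by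
  -- The variables, innermost quantifier first, are `(c, y, v)` in `hbase` and `hvalue` and
  -- `(m, c, y, v)` in `hstep`: see `eq_natRec_iff_exists_beta`; `v` is the argument.
  have hbase := ArithRel.eq ((var (n := 3) 0).beta zero) (hF.comp₁ (var 2).unpair_fst)
  have hvalue := ArithRel.eq (var (n := 3) 1) ((var 0).beta (var 2).unpair_snd)
  have hstep := (ArithRel.lt (var (n := 4) 0) (var 3).unpair_snd).imp
    (.eq ((var 1).beta ((var 0).add one))
      (hG.comp₁ ((var 3).unpair_fst.pair ((var 0).pair ((var 1).beta (var 0))))))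
  exact of_graph (.ex (hbase.and (hvalue.and (.all hstep)))) fun v y =>
    eq_natRec_iff_exists_beta.symm

theorem of_primrec {F : ℕ → ℕ} (hF : Nat.Primrec F) : ArithFun fun v : Fin 1 → ℕ => F (v 0) := by
  induction hF with
  | zero => exact zero
  | succ => exact (var 0).add one
  | left => exact (var 0).unpair_fst
  | right => exact (var 0).unpair_snd
  | pair _ _ hF hG => exact hF.pair hG
  | comp _ _ hF hG => exact hF.comp₁ hG
  | prec _ _ hF hG => exact hF.prec hG

end ArithFun

/-! ### Arithmetical predicates on encoded data -/

/-- An arithmetical predicate on a type with a coding in the natural numbers: the set of the codes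
of the elements that satisfy it is arithmetical. A number that decodes to nothing is in no such
set. -/
def ArithPred {α : Type*} [Primcodable α] (P : α → Prop) : Prop :=
  ArithRel fun v : Fin 1 → ℕ => ∃ a ∈ (Encodable.decode (v 0) : Option α), P a

namespace ArithPred

variable {α β : Type*} [Primcodable α] [Primcodable β]

theorem comp_primrec {P : β → Prop} {f : α → β} (hP : ArithPred P) (hf : Primrec f) :
    ArithPred fun a => P (f a) := by
  have hF : ArithFun fun v : Fin 1 → ℕ =>
      Encodable.encode ((Encodable.decode (v 0) : Option α).map f) := .of_primrec hf
  refine (ArithRel.ex (R := fun v m =>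
    Encodable.encode ((Encodable.decode (v 0) : Option α).map f) = m + 1 ∧
      ∃ b ∈ (Encodable.decode m : Option β), P b)
    (.and (.eq hF.weaken ((ArithFun.var 0).add .one)) (ArithRel.comp hP ![0]))).of_iff fun v => ?_
  cases (Encodable.decode (v 0) : Option α) <;> simp

theorem of_primrecPred {P : α → Prop} (hP : PrimrecPred P) : ArithPred P := by
  obtain ⟨_, hP⟩ := hP
  have hF : ArithFun fun v : Fin 1 → ℕ =>
      Encodable.encode ((Encodable.decode (v 0) : Option α).map fun a => decide (P a)) :=
    .of_primrec hP
  refine (ArithRel.eq hF (ArithFun.one.add .one)).of_iff fun v => ?_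
  rcases (Encodable.decode (v 0) : Option α) with _ | a
  · simp
  · by_cases h : P a <;> simp [h]

protected theorem not {P : α → Prop} (hP : ArithPred P) : ArithPred fun a => ¬ P a := by
  have hdecode : ArithPred fun _ : α => True := of_primrecPred ⟨inferInstance, .const _⟩
  refine (ArithRel.and hdecode (ArithRel.not hP)).of_iff fun v => ?_
  cases (Encodable.decode (v 0) : Option α) <;> simp

protected theorem ex {P : α → β → Prop} (hP : ArithPred fun c : α × β => P c.1 c.2) :
    ArithPred fun a => ∃ b, P a b := by
  have hpair := (ArithFun.var (n := 2) 1).pair (.var 0)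
  refine (ArithRel.ex (R := fun v m =>
    ∃ c ∈ (Encodable.decode (Nat.pair (v 0) m) : Option (α × β)), P c.1 c.2)
    (ArithRel.subst (R := fun _ k => ∃ c ∈ (Encodable.decode k : Option (α × β)), P c.1 c.2)
      (ArithRel.comp hP ![0]) hpair)).of_iff fun v => ?_
  simp only [Encodable.decode_prod_val, Nat.unpair_pair]
  rcases (Encodable.decode (v 0) : Option α) with _ | a
  · simp
  · suffices (∃ b, (∃ m, Encodable.decode m = some b) ∧ P a b) ↔ ∃ b, P a b by
      simpa [← exists_and_right, exists_comm (α := ℕ)]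
    exact exists_congr fun b => and_iff_right ⟨_, Encodable.encodek b⟩

end ArithPred

/-! ### Halting of a Turing machine is arithmetical -/

instance : Finite Sym := by
  rw [← Set.finite_univ_iff]
  refine ((Set.finite_range Sym.letter).union ((Set.finite_range Sym.digit).union (Set.toFinite
    {.quote, .backslash, .eq, .ne, .lpar, .rpar, .tilde, .amp, .bar, .dash, .gt, .capA, .capE,
      .colon, .plus, .star, .lt}))).subset fun s _ => ?_
  cases s <;> simp

noncomputable instance : Primcodable Sym := Primcodable.ofEquiv _ (Finite.equivFin Sym)

theorem primrec₂_of_finite {ι α σ : Type*} [Finite ι] [Primcodable ι] [Primcodable α]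
    [Primcodable σ] {f : ι → α → σ} (hf : ∀ i, Primrec (f i)) : Primrec₂ f := by
  let e := Finite.equivFin ι
  have hfin : Primrec₂ fun i : Fin (Nat.card ι) => f (e.symm i) :=
    Primrec.fin_curry₁.2 fun i => hf (e.symm i)
  exact (hfin.comp ((Primrec.dom_finite e).comp Primrec.fst) Primrec.snd).of_eq fun c => by simp

/-- The effect of a head movement on the list of the cells to the left of the head, with the nearest
cell first, and the list of the other cells. -/
def Move.shift : Move → List TapeSym × List TapeSym → List TapeSym × List TapeSym
  | .L, (l, r) => (l.tail, l.headI :: r)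
  | .R, (l, r) => (r.headI :: l, r.tail)
  | .N, (l, r) => (l, r)

theorem Move.mk₂_shift (m : Move) (t : List TapeSym × List TapeSym) :
    Turing.Tape.mk₂ (m.shift t).1 (m.shift t).2 = m.apply (.mk₂ t.1 t.2) := by
  obtain ⟨l, r⟩ := t
  cases m
  · exact (Turing.Tape.move_left_mk' (.mk l) (.mk r)).symm
  · exact (Turing.Tape.move_right_mk' (.mk l) (.mk r)).symm
  · rfl

theorem Move.primrec_shift (m : Move) : Primrec m.shift := by
  cases m
  · exact (Primrec.list_tail.comp .fst).pair
      (Primrec.list_cons.comp (Primrec.list_headI.comp .fst) .snd)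
  · exact (Primrec.list_cons.comp (Primrec.list_headI.comp .snd) .fst).pair
      (Primrec.list_tail.comp .snd)
  · exact .id

namespace Machine

/-- A configuration given by the state and two finite lists, for the cells to the left of the head
and for the other cells. Unlike `Config`, this is a type of finite data, on which primitive
recursion makes sense. -/
abbrev ListConfig (M : Machine) : Type := Fin (M.r + 1) × List TapeSym × List TapeSym

variable (M : Machine)

/-- The configuration that a list configuration stands for. -/
def toConfig (c : M.ListConfig) : M.Config := ⟨c.1, .mk₂ c.2.1 c.2.2⟩

/-- The counterpart of `init` for list configurations. -/
def listInit (s : Str) : M.ListConfig := (⟨1, Nat.succ_lt_succ M.r_pos⟩, [], s.map some)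

/-- The step that a list configuration makes if `i` is its state together with the symbol under its
head. The parameter `i` has finitely many values, so that primitive recursiveness of the step can be
shown for each value separately. -/
def lookupStep (i : Fin (M.r + 1) × TapeSym) (c : M.ListConfig) : M.ListConfig :=
  if h : i.1 = 0 then c
  else
    let a := M.rule i.2 ⟨i.1, h⟩
    ⟨a.2.1, a.2.2.shift (c.2.1, a.1 :: c.2.2.tail)⟩

/-- The counterpart of `step` for list configurations. -/
def listStep (c : M.ListConfig) : M.ListConfig := M.lookupStep (c.1, c.2.2.headI) c

theorem toConfig_listStep (c : M.ListConfig) :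
    M.toConfig (M.listStep c) = M.step (M.toConfig c) := by
  have hwrite (a : TapeSym) :
      (Turing.Tape.mk₂ c.2.1 c.2.2).write a = .mk₂ c.2.1 (a :: c.2.2.tail) :=
    Turing.Tape.write_mk' a (.mk c.2.1) (.mk c.2.2)
  have hhead : (Turing.Tape.mk₂ c.2.1 c.2.2).head = c.2.2.headI := rfl
  by_cases h : c.1 = 0
  · simp [listStep, lookupStep, step, toConfig, h]
  · simp [listStep, lookupStep, step, toConfig, h, Move.mk₂_shift, hwrite, hhead]

theorem primrec_lookupStep (i : Fin (M.r + 1) × TapeSym) : Primrec (M.lookupStep i) := by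
  unfold lookupStep
  split_ifs with h
  · exact .id
  · have htail : Primrec fun c : M.ListConfig => c.2.2.tail :=
      Primrec.list_tail.comp (Primrec.snd.comp .snd)
    exact (Primrec.const _).pair ((Move.primrec_shift _).comp
      ((Primrec.fst.comp .snd).pair (Primrec.list_cons.comp (.const _) htail)))

theorem primrec_listStep : Primrec M.listStep :=
  (primrec₂_of_finite M.primrec_lookupStep).comp
    (Primrec.fst.pair (Primrec.list_headI.comp (Primrec.snd.comp .snd))) .id

theorem halts_iff_exists_listStep (s : Str) :
    M.Halts s ↔ ∃ n, (M.listStep^[n] (M.listInit s)).1 = 0 := by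
  have hiterate (n : ℕ) :
      M.step^[n] (M.init s) = M.toConfig (M.listStep^[n] (M.listInit s)) :=
    (Function.Semiconj.iterate_right (f := M.toConfig) M.toConfig_listStep n (M.listInit s)).symm
  exact exists_congr fun n => by rw [hiterate]; rfl

theorem arithPred_halts : ArithPred M.Halts := by
  have hinit : Primrec M.listInit := (Primrec.const _).pair ((Primrec.const _).pair
    (Primrec.list_map .id (Primrec.option_some.comp .snd)))
  have hrun : Primrec fun c : Str × ℕ => (M.listStep^[c.2] (M.listInit c.1)).1 :=
    Primrec.fst.comp (Primrec.nat_iterate .snd (hinit.comp .fst) (M.primrec_listStep.comp .snd))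
  have hfinal : ArithPred fun c : Str × ℕ => (M.listStep^[c.2] (M.listInit c.1)).1 = 0 :=
    .of_primrecPred (Primrec.eq.comp hrun (.const 0))
  rw [funext fun s => propext (M.halts_iff_exists_listStep s)]
  exact hfinal.ex

end Machine

/-! ### The diagonal lemma -/

/-- The string `0+1+…+1` with `n` ones: a closed term that denotes `n` and is easier to compute than
the decimal literal. -/
def numeral (n : ℕ) : Str :=
  n.rec (motive := fun _ => Str) [.digit 0] fun _ s => s ++ [.plus, .digit 1]

theorem readsTm_numeral (n : ℕ) :
    ∃ t : Tm, ReadsTm 0 (numeral n) t ∧ t.vars = ∅ ∧ ∀ v, t.val v = n := by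
  induction n with
  | zero => exact ⟨_, (ReadsTm.lit [0] (.inl rfl)).to_zero, rfl, fun _ => rfl⟩
  | succ n ih =>
    obtain ⟨t, hs, hvars, ht⟩ := ih
    have hsucc := ReadsTm.add hs (ReadsTm.lit [1] (.inr (by decide))).weaken
    refine ⟨_, by simpa [numeral] using hsucc, by simp [Tm.vars, hvars], fun v => ?_⟩
    simp [Tm.val, ht, decimalValue]

theorem primrec_numeral : Primrec numeral :=
  Primrec.nat_rec₁ _ (Primrec.list_append.comp Primrec.snd (Primrec.const _)).to₂

/-- The formula `Ex:x=n&s`, which expresses that the formula `s` holds for the value `n` of the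
variable `x`, without a substitution in `s`. -/
def instantiate (x : Var) (s : Str) (n : ℕ) : Str :=
  [.capE] ++ x.str ++ [.colon] ++ (x.str ++ [.eq] ++ numeral n ++ [.amp] ++ s)

theorem exists_isFormula_instantiate {x : Var} {s : Str} {p : Fml} (hs : ReadsFml 4 false s p)
    (hfree : p.free ⊆ {x}) (n : ℕ) :
    ∃ q, IsFormula (instantiate x s n) q ∧ q.free = ∅ ∧
      ∀ v, q.Holds v ↔ p.Holds (Function.update v x n) := by
  obtain ⟨t, ht, hvars, hval⟩ := readsTm_numeral n
  have heq := ReadsFml.eq (ReadsTm.var x).to_zero ht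
  refine ⟨.ex x (.and (.eq (.var x) t) p),
    ⟨true, (ReadsFml.ex x (ReadsFml.and heq.weaken.weaken hs.weaken).to_zero).to_zero⟩, ?_,
    fun v => ?_⟩
  · simpa [Fml.free, Tm.vars, hvars, Set.sdiff_eq_empty] using hfree
  · simp [Fml.Holds, Tm.val, hval]

/-- The diagonalization of a formula: its instance at its own code. -/
noncomputable def diagonalization (x : Var) (s : Str) : Str :=
  instantiate x s (Encodable.encode s)

theorem primrec_diagonalization (x : Var) : Primrec (diagonalization x) :=
  Primrec.list_append.comp (.const _) (Primrec.list_append.comp (Primrec.list_append.comp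
    (Primrec.list_append.comp (.const _) (primrec_numeral.comp .encode)) (.const _)) .id)

theorem exists_sentence_holds_iff {A : Str → Prop} (hA : ArithPred A) :
    ∃ s p, IsFormula s p ∧ p.free = ∅ ∧ ∀ v, p.Holds v ↔ A s := by
  let x : Var := ⟨0, []⟩
  obtain ⟨s, p, hs, hfree, hp⟩ := hA.comp_primrec (primrec_diagonalization x) fun _ => x
  obtain ⟨q, hq, hclosed, hqp⟩ :=
    exists_isFormula_instantiate hs (hfree.trans Set.range_const_subset) (Encodable.encode s)
  exact ⟨diagonalization x s, q, hq, hclosed, fun v => by simp [hqp, hp]⟩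

theorem IsFalseSentence.isSentence {s : Str} : IsFalseSentence s → IsSentence s
  | ⟨p, hs, hfree, _⟩ => ⟨p, hs, hfree⟩

end NatArith

theorem theorem2_general {A : NatArith.Str → Prop} (hA : NatArith.ArithPred A) :
    (∃ s, NatArith.IsFalseSentence s ∧ A s) ∨ (∃ s, NatArith.IsTrueSentence s ∧ ¬ A s) := by
  obtain ⟨s, p, hs, hfree, hp⟩ := NatArith.exists_sentence_holds_iff hA.not
  by_cases h : A s
  · exact .inl ⟨s, ⟨p, hs, hfree, fun v hv => (hp v).1 hv h⟩, h⟩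
  · exact .inr ⟨s, ⟨p, hs, hfree, fun v => (hp v).2 h⟩, h⟩

theorem theorem2 (P : NatArith.REProofSystem) :
    (∃ s : NatArith.Str, NatArith.IsFalseSentence s ∧ P.Proves s) ∨
      (∃ s : NatArith.Str, NatArith.IsTrueSentence s ∧ ¬ P.Proves s) :=
  (theorem2_general P.machine.arithPred_halts).imp
    (fun ⟨s, hs, h⟩ => ⟨s, hs, hs.isSentence, h⟩) (fun ⟨s, hs, h⟩ => ⟨s, hs, fun hP => h hP.2⟩)
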